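/- A bumpless pipe dream of size $n$ is a tiling of the $n\times n$ grid (rows numbered from top to bottom, columns from left to right) by the six tiles blank, horizontal, vertical, cross, r-elbow (joining the south and east sides of its cell) and j-elbow (joining the west and north sides), whose strands fit together to $n$ pipes, such that one pipe enters from the south border in each column, one leaves through the east border in each row, and no strand meets the north or west border. Pipes are traversed from south to east; write $y\to x$ for the pipe that enters in column $y$ and leaves in row $x$. The permutation $w_B\in S_n$ of $B$ is given by $w_B(x)=y$ for each pipe $y\to x$ of $B$. Two pipes cross once for each cross tile that they share, and $B$ is reduced if any two distinct pipes cross at most once. The $K$-theoretic diagram $B_K$ is obtained from $B$ by going through the cross tiles from southwest to northeast (say column by column from left to right, each column from bottom to top) and replacing a cross by a bump tile (joining west to north, and south to east) whenever the two pipes that meet there, in the diagram obtained so far, have already crossed earlier. The type $\partial(B)\in S_n$ is the permutation of $B_K$, read off from its pipes in the same way. A permutation contains a pattern if some subword of its one-line notation is order isomorphic to the pattern. Proposition. Let $B$ be a bumpless pipe dream of size $n$ that is not reduced. (a) The permutation $w_B$ contains a $1243$ pattern or a $2143$ pattern. More precisely, if $B$ has two distinct pipes that cross a nonzero even number of times,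 then $w_B$ contains a $1243$ pattern, and if $B$ has two distinct pipes that cross an odd number of times, and at least twice (that is, an odd number $\geq 3$ of times), then $w_B$ contains a $2143$ pattern. (b) The type $\partial(B)$ contains a $2143$ pattern. -/

import Mathlib

/-- The tiles of a pipe diagram: the six tiles of a bumpless pipe dream, and the bump tile.
`relbow` joins the south and east sides of its cell, `jelbow` joins the west and north sides,
and `bump` does both. -/
inductive Tile
  | blank
  | horizontal
  | vertical
  | cross
  | relbow
  | jelbow
  | bump

/-- The side from which a pipe, traversed from south to east, comes into a cell. -/
inductive EntrySide
  | south
  | west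

/-- The side through which a pipe, traversed from south to east, leaves a cell. -/
inductive ExitSide
  | north
  | east

namespace Tile

/-- The side through which a pipe that comes into the tile from the given side leaves it
(`none` if no pipe of the tile touches that side). -/
def exit : Tile → EntrySide → Option ExitSide
  | blank, _ => none
  | horizontal, .west => some .east
  | horizontal, .south => none
  | vertical, .south => some .north
  | vertical, .west => none
  | cross, .west => some .east
  | cross, .south => some .north
  | relbow, .south => some .east
  | relbow, .west => none
  | jelbow, .west => some .north
  | jelbow, .south => none
  | bump, .west => some .north
  | bump, .south => some .east

/-- A pipe of the tile touches the south side. -/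
def South (t : Tile) : Prop := t.exit .south ≠ none

/-- A pipe of the tile touches the west side. -/
def West (t : Tile) : Prop := t.exit .west ≠ none

/-- A pipe of the tile touches the north side. -/
def North (t : Tile) : Prop := ∃ e, t.exit e = some .north

/-- A pipe of the tile touches the east side. -/
def East (t : Tile) : Prop := ∃ e, t.exit e = some .east

theorem exit_inj {t : Tile} {e e' : EntrySide} {o : ExitSide}
    (h : t.exit e = some o) (h' : t.exit e' = some o) : e = e' := by
  cases t <;> cases e <;> cases e' <;> cases o <;> simp_all [exit]

end Tile

/-- A filling of the `n × n` grid (rows from top to bottom, columns from left to right) by tiles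
whose strands fit together to `n` pipes: one comes in from the south in each column, one leaves
to the east in each row, and none meets the north or the west border of the grid. -/
structure PipeDiagram (n : ℕ) where
  tile : Fin n → Fin n → Tile
  vertical_match : ∀ i i' j : Fin n, i.val + 1 = i'.val →
    ((tile i j).South ↔ (tile i' j).North)
  horizontal_match : ∀ i j j' : Fin n, j.val + 1 = j'.val →
    ((tile i j).East ↔ (tile i j').West)
  north_border : ∀ i j : Fin n, i.val = 0 → ¬ (tile i j).North
  west_border : ∀ i j : Fin n, j.val = 0 → ¬ (tile i j).West
  south_border : ∀ i j : Fin n, i.val + 1 = n → (tile i j).South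
  east_border : ∀ i j : Fin n, j.val + 1 = n → (tile i j).East

namespace PipeDiagram

variable {n : ℕ}

/-- `D.Visits y e i j`: the pipe of `D` that comes in from the south border in column `y`
comes into the cell in row `i` and column `j` from the side `e`. -/
inductive Visits (D : PipeDiagram n) (y : Fin n) : EntrySide → Fin n → Fin n → Prop
  | start (i : Fin n) (hi : i.val + 1 = n) : D.Visits y .south i y
  | up {e : EntrySide} {i j : Fin n} (i' : Fin n) (h : D.Visits y e i j)
      (ho : (D.tile i j).exit e = some .north) (hi : i'.val + 1 = i.val) :
      D.Visits y .south i' j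
  | right {e : EntrySide} {i j : Fin n} (j' : Fin n) (h : D.Visits y e i j)
      (ho : (D.tile i j).exit e = some .east) (hj : j.val + 1 = j'.val) :
      D.Visits y .west i j'

/-- `D.IsPipe y x`: `y → x` is a pipe of `D`, that is, the pipe coming in from the south in
column `y` leaves to the east in row `x`. -/
def IsPipe (D : PipeDiagram n) (y x : Fin n) : Prop :=
  ∃ (e : EntrySide) (j : Fin n), j.val + 1 = n ∧ D.Visits y e x j ∧
    (D.tile x j).exit e = some .east

theorem Visits.exit_ne_none {D : PipeDiagram n} {y : Fin n} {e : EntrySide} {i j : Fin n}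
    (h : D.Visits y e i j) : (D.tile i j).exit e ≠ none := by
  cases h with
  | start _ hi => exact D.south_border _ _ hi
  | up _ h ho hi => exact (D.vertical_match _ _ _ hi).2 ⟨_, ho⟩
  | right _ h ho hj => exact (D.horizontal_match _ _ _ hj).1 ⟨_, ho⟩

theorem Visits.eq {D : PipeDiagram n} {y : Fin n} {e : EntrySide} {i j : Fin n}
    (h : D.Visits y e i j) {y' : Fin n} (h' : D.Visits y' e i j) : y = y' := by
  induction h with
  | start i hi =>
    cases h' with
    | start => rfl
    | up _ h ho hi' => have := Fin.is_lt ‹Fin n›; omega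
  | @up e i j i' h ho hi ih =>
    cases h' with
    | start _ hi' => have := i.is_lt; omega
    | @up e₂ i₂ _ _ h₂ ho₂ hi₂ =>
      obtain rfl : i = i₂ := Fin.ext (by omega)
      obtain rfl := Tile.exit_inj ho ho₂
      exact ih h₂
  | @right e i j j' h ho hj ih =>
    cases h' with
    | @right e₂ _ j₂ _ h₂ ho₂ hj₂ =>
      obtain rfl : j = j₂ := Fin.ext (by omega)
      obtain rfl := Tile.exit_inj ho ho₂
      exact ih h₂

theorem Visits.exists_isPipe {D : PipeDiagram n} {y : Fin n} :
    ∀ (k : ℕ) {e : EntrySide} {i j : Fin n}, D.Visits y e i j → i.val + (n - j.val) = k →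
      ∃ x, D.IsPipe y x := by
  intro k
  induction k using Nat.strong_induction_on with
  | _ k ih =>
    intro e i j h hk
    have hj := j.is_lt
    cases ho : (D.tile i j).exit e with
    | none => exact absurd ho h.exit_ne_none
    | some o =>
      cases o with
      | north =>
        have h0 : i.val ≠ 0 := fun h0 => D.north_border i j h0 ⟨e, ho⟩
        have hi := i.is_lt
        exact ih _ (by simp only []; omega)
          (h.up ⟨i.val - 1, by omega⟩ ho (by simp only []; omega)) rfl
      | east =>
        by_cases hn : j.val + 1 = n
        · exact ⟨i, e, j, hn, h, ho⟩
        · exact ih _ (by simp only []; omega)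
            (h.right ⟨j.val + 1, by omega⟩ ho rfl) rfl

theorem exists_isPipe (D : PipeDiagram n) (y : Fin n) : ∃ x, D.IsPipe y x := by
  have hy := y.is_lt
  exact Visits.exists_isPipe _
    (Visits.start (D := D) (y := y) ⟨n - 1, by omega⟩ (by simp only []; omega)) rfl

theorem IsPipe.eq {D : PipeDiagram n} {y y' x : Fin n} (h : D.IsPipe y x)
    (h' : D.IsPipe y' x) : y = y' := by
  obtain ⟨e, j, hj, hv, ho⟩ := h
  obtain ⟨e', j', hj', hv', ho'⟩ := h'
  obtain rfl : j = j' := Fin.ext (by omega)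
  obtain rfl := Tile.exit_inj ho ho'
  exact hv.eq hv'

theorem bijective_exit (D : PipeDiagram n) :
    Function.Bijective (fun y => (D.exists_isPipe y).choose) := by
  refine Finite.injective_iff_bijective.1 fun y y' h => ?_
  have h₁ := (D.exists_isPipe y).choose_spec
  have h₂ := (D.exists_isPipe y').choose_spec
  rw [h] at h₁
  exact h₁.eq h₂

/-- The permutation of a pipe diagram: it takes `x` to `y` for each pipe `y → x`
(see `perm_eq_iff`). -/
noncomputable def perm (D : PipeDiagram n) : Equiv.Perm (Fin n) :=
  (Equiv.ofBijective _ D.bijective_exit).symm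

theorem isPipe_perm (D : PipeDiagram n) (x : Fin n) : D.IsPipe (D.perm x) x := by
  have h := (D.exists_isPipe (D.perm x)).choose_spec
  have h' : (D.exists_isPipe (D.perm x)).choose = x :=
    (Equiv.ofBijective _ D.bijective_exit).apply_symm_apply x
  rwa [h'] at h

theorem perm_eq_iff (D : PipeDiagram n) (x y : Fin n) : D.perm x = y ↔ D.IsPipe y x :=
  ⟨fun h => h ▸ D.isPipe_perm x, fun h => (D.isPipe_perm x).eq h⟩

/-- The pipes coming in in columns `y` and `y'` cross each other at the cell `c`. -/
def CrossAt (D : PipeDiagram n) (y y' : Fin n) (c : Fin n × Fin n) : Prop :=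
  D.tile c.1 c.2 = .cross ∧
    ((D.Visits y .west c.1 c.2 ∧ D.Visits y' .south c.1 c.2) ∨
      (D.Visits y .south c.1 c.2 ∧ D.Visits y' .west c.1 c.2))

/-- The number of times that the pipes coming in in columns `y` and `y'` cross. -/
noncomputable def crossings (D : PipeDiagram n) (y y' : Fin n) : ℕ :=
  {c : Fin n × Fin n | D.CrossAt y y' c}.ncard

/-- A pipe diagram is reduced if any two distinct pipes cross at most once. -/
def IsReduced (D : PipeDiagram n) : Prop :=
  ∀ y y' : Fin n, y ≠ y' → D.crossings y y' ≤ 1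

/-- The cell `c` is a cross of two pipes that have crossed before, when they are traversed from
south to east. (Pipes run only north and east, so what lies before `c` lies weakly southwest.) -/
def IsRedundant (D : PipeDiagram n) (c : Fin n × Fin n) : Prop :=
  ∃ y y' : Fin n, D.CrossAt y y' c ∧
    ∃ c' : Fin n × Fin n, c' ≠ c ∧ c.1 ≤ c'.1 ∧ c'.2 ≤ c.2 ∧ D.CrossAt y y' c'

open Classical in
/-- The tile of `D` at `(i, j)`, with a cross at the cell `c` replaced by a bump. -/
noncomputable def bumpTile (D : PipeDiagram n) (c : Fin n × Fin n) (i j : Fin n) : Tile :=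
  if (i, j) = c ∧ D.tile i j = .cross then .bump else D.tile i j

theorem bumpTile_sides (D : PipeDiagram n) (c : Fin n × Fin n) (i j : Fin n) :
    ((D.bumpTile c i j).South ↔ (D.tile i j).South) ∧
    ((D.bumpTile c i j).West ↔ (D.tile i j).West) ∧
    ((D.bumpTile c i j).North ↔ (D.tile i j).North) ∧
    ((D.bumpTile c i j).East ↔ (D.tile i j).East) := by
  unfold bumpTile
  split_ifs with h
  · rw [h.2]
    have hS : ∀ t : Tile, t = .cross ∨ t = .bump → t.South ∧ t.West ∧ t.North ∧ t.East := by
      rintro t (rfl | rfl)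
      · exact ⟨by simp [Tile.South, Tile.exit], by simp [Tile.West, Tile.exit],
          ⟨.south, rfl⟩, ⟨.west, rfl⟩⟩
      · exact ⟨by simp [Tile.South, Tile.exit], by simp [Tile.West, Tile.exit],
          ⟨.west, rfl⟩, ⟨.south, rfl⟩⟩
    have h₁ := hS .cross (Or.inl rfl)
    have h₂ := hS .bump (Or.inr rfl)
    tauto
  · simp

/-- Replace the cross of `D` at the cell `c` (if there is one) by a bump. -/
noncomputable def replaceCross (D : PipeDiagram n) (c : Fin n × Fin n) : PipeDiagram n where
  tile := D.bumpTile c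
  vertical_match i i' j h := by
    rw [(D.bumpTile_sides c i j).1, (D.bumpTile_sides c i' j).2.2.1]
    exact D.vertical_match i i' j h
  horizontal_match i j j' h := by
    rw [(D.bumpTile_sides c i j).2.2.2, (D.bumpTile_sides c i j').2.1]
    exact D.horizontal_match i j j' h
  north_border i j h := by
    rw [(D.bumpTile_sides c i j).2.2.1]; exact D.north_border i j h
  west_border i j h := by
    rw [(D.bumpTile_sides c i j).2.1]; exact D.west_border i j h
  south_border i j h := by
    rw [(D.bumpTile_sides c i j).1]; exact D.south_border i j h
  east_border i j h := by
    rw [(D.bumpTile_sides c i j).2.2.2]; exact D.east_border i j h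

open Classical in
/-- Replace the cross at `c` by a bump if it is redundant in `D`. -/
noncomputable def resolveAt (D : PipeDiagram n) (c : Fin n × Fin n) : PipeDiagram n :=
  if D.IsRedundant c then D.replaceCross c else D

end PipeDiagram

/-- The cells of the `n × n` grid, column by column from left to right and each column from
bottom to top: every cell comes after the cells to the southwest of it. -/
def cellOrder (n : ℕ) : List (Fin n × Fin n) :=
  (List.finRange n).flatMap fun j => (List.finRange n).reverse.map fun i => (i, j)

/-- A bumpless pipe dream of size `n`. -/
structure BPD (n : ℕ) extends PipeDiagram n where
  bumpless : ∀ i j : Fin n, tile i j ≠ .bump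

namespace BPD

variable {n : ℕ}

/-- The K-theoretic diagram `B_K` of a bumpless pipe dream `B`: going through the cells from
southwest to northeast, every cross of two pipes that have crossed before (in the diagram
obtained so far) is replaced by a bump. -/
noncomputable def kDiagram (B : BPD n) : PipeDiagram n :=
  (cellOrder n).foldl PipeDiagram.resolveAt B.toPipeDiagram

/-- The type `∂(B)` of a bumpless pipe dream. -/
noncomputable def type (B : BPD n) : Equiv.Perm (Fin n) := B.kDiagram.perm

end BPD

/-- The permutation `w` contains the pattern `p`: some subword of `w` is order isomorphic to
the one-line notation of `p`. -/
def ContainsPattern {n k : ℕ} (w : Equiv.Perm (Fin n)) (p : Equiv.Perm (Fin k)) : Prop :=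
  ∃ f : Fin k → Fin n, StrictMono f ∧ ∀ a b : Fin k, w (f a) < w (f b) ↔ p a < p b

/-- The permutation with one-line notation `1243` (written `0132` on `Fin 4`). -/
def pattern1243 : Equiv.Perm (Fin 4) := Equiv.swap 2 3

/-- The permutation with one-line notation `2143` (written `1032` on `Fin 4`). -/
def pattern2143 : Equiv.Perm (Fin 4) := Equiv.swap 0 1 * Equiv.swap 2 3

namespace PipeDiagram

variable {n : ℕ}

/-- The tile of `D` at `(i, j)`, where the grid is continued by vertical tiles below it and by
horizontal tiles to its right. -/
def extTile (D : PipeDiagram n) (i j : ℕ) : Tile :=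
  if h : i < n ∧ j < n then D.tile ⟨i, h.1⟩ ⟨j, h.2⟩ else if j < n then .vertical else .horizontal

/-- One step of a pipe through the continued grid: from the side and the cell at which it comes
in to the side and the cell at which it comes in next. -/
def step (D : PipeDiagram n) (s : EntrySide × ℕ × ℕ) : EntrySide × ℕ × ℕ :=
  match (D.extTile s.2.1 s.2.2).exit s.1 with
  | some .east => (.west, s.2.1, s.2.2 + 1)
  | _ => (.south, s.2.1 - 1, s.2.2)

/-- The position after `t` steps of the pipe with starting column `y`, starting in row `n + y` of
the continued grid, so that all pipes are on the same diagonal at the same time. -/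
def walk (D : PipeDiagram n) (y : Fin n) (t : ℕ) : EntrySide × ℕ × ℕ :=
  D.step^[t] (.south, n + y.val, y.val)

theorem extTile_val (D : PipeDiagram n) (i j : Fin n) :
    D.extTile i.val j.val = D.tile i j := by
  simp [extTile]

theorem walk_zero (D : PipeDiagram n) (y : Fin n) :
    D.walk y 0 = (.south, n + y.val, y.val) := rfl

theorem walk_succ (D : PipeDiagram n) (y : Fin n) (t : ℕ) :
    D.walk y (t + 1) = D.step (D.walk y t) :=
  Function.iterate_succ_apply' _ _ _

/-- A position of the pipe `y` in the continued grid: below, in, or to the right of the grid. -/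
inductive OnPipe (D : PipeDiagram n) (y : Fin n) : EntrySide × ℕ × ℕ → Prop
  | below (i : ℕ) (hi : n ≤ i) : OnPipe D y (.south, i, y.val)
  | inside {e : EntrySide} {i j : Fin n} (h : D.Visits y e i j) : OnPipe D y (e, i.val, j.val)
  | beyond {x : Fin n} (j : ℕ) (hj : n ≤ j) (h : D.IsPipe y x) : OnPipe D y (.west, x.val, j)

theorem extTile_below (D : PipeDiagram n) {i j : ℕ} (hi : n ≤ i) (hj : j < n) :
    D.extTile i j = .vertical := by
  rw [extTile, dif_neg (by omega), if_pos hj]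

theorem extTile_beyond (D : PipeDiagram n) {i j : ℕ} (hj : n ≤ j) :
    D.extTile i j = .horizontal := by
  rw [extTile, dif_neg (by omega), if_neg (by omega)]

theorem OnPipe.step {D : PipeDiagram n} {y : Fin n} {e : EntrySide} {i j : ℕ}
    (h : D.OnPipe y (e, i, j)) :
    ((D.extTile i j).exit e = some .north ∧ 0 < i ∧ D.step (e, i, j) = (.south, i - 1, j) ∧
      D.OnPipe y (.south, i - 1, j)) ∨
    ((D.extTile i j).exit e = some .east ∧ D.step (e, i, j) = (.west, i, j + 1) ∧
      D.OnPipe y (.west, i, j + 1)) := by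
  cases h with
  | below _ hi =>
    have hy := y.is_lt
    have ht := D.extTile_below hi hy
    refine Or.inl ⟨by rw [ht]; rfl, by omega, by simp [PipeDiagram.step, ht, Tile.exit], ?_⟩
    rcases Nat.eq_or_lt_of_le hi with rfl | hi
    · exact .inside (i := ⟨n - 1, by omega⟩) (.start _ (by simp only []; omega))
    · exact .below _ (by omega)
  | @inside _ i j h =>
    have ht := D.extTile_val i j
    cases ho : (D.tile i j).exit e with
    | none => exact absurd ho h.exit_ne_none
    | some o =>
      cases o with
      | north =>
        have h0 : i.val ≠ 0 := fun h0 => D.north_border i j h0 ⟨e, ho⟩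
        have hi := i.is_lt
        refine Or.inl ⟨by rw [ht, ho], by omega, by simp [PipeDiagram.step, ht, ho], ?_⟩
        exact .inside (h.up ⟨i.val - 1, by omega⟩ ho (by simp only []; omega))
      | east =>
        refine Or.inr ⟨by rw [ht, ho], by simp [PipeDiagram.step, ht, ho], ?_⟩
        by_cases hn : j.val + 1 = n
        · exact .beyond _ hn.ge ⟨e, j, hn, h, ho⟩
        · exact .inside (h.right ⟨j.val + 1, by omega⟩ ho rfl)
  | @beyond x _ hj h =>
    have ht := D.extTile_beyond (i := x) hj
    exact Or.inr ⟨by rw [ht]; rfl, by simp [PipeDiagram.step, ht, Tile.exit],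
      .beyond _ (by omega) h⟩

theorem onPipe_walk (D : PipeDiagram n) (y : Fin n) (t : ℕ) : D.OnPipe y (D.walk y t) := by
  induction t with
  | zero => exact .below _ (by omega)
  | succ t ih =>
    rw [walk_succ]
    rcases ih.step with h | h
    · exact h.2.2.1 ▸ h.2.2.2
    · exact h.2.1 ▸ h.2.2

theorem walk_succ_cases (D : PipeDiagram n) (y : Fin n) (t : ℕ) {e : EntrySide} {i j : ℕ}
    (h : D.walk y t = (e, i, j)) :
    ((D.extTile i j).exit e = some .north ∧ 0 < i ∧ D.walk y (t + 1) = (.south, i - 1, j)) ∨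
    ((D.extTile i j).exit e = some .east ∧ D.walk y (t + 1) = (.west, i, j + 1)) := by
  have hp := D.onPipe_walk y t
  rw [walk_succ, h]
  rw [h] at hp
  rcases hp.step with h | h
  · exact Or.inl ⟨h.1, h.2.1, h.2.2.1⟩
  · exact Or.inr ⟨h.1, h.2.1⟩

theorem walk_diagonal (D : PipeDiagram n) (y : Fin n) (t : ℕ) :
    (D.walk y t).2.1 + t = n + (D.walk y t).2.2 := by
  induction t with
  | zero => rfl
  | succ t ih =>
    rcases h : D.walk y t with ⟨e, i, j⟩
    rw [h] at ih
    simp only [] at ih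
    rcases D.walk_succ_cases y t h with ⟨_, h0, h⟩ | ⟨_, h⟩ <;> rw [h] <;> simp only [] <;> omega

theorem walk_mono (D : PipeDiagram n) (y : Fin n) {t t' : ℕ} (ht : t ≤ t') :
    (D.walk y t').2.1 ≤ (D.walk y t).2.1 ∧ (D.walk y t).2.2 ≤ (D.walk y t').2.2 := by
  induction t', ht using Nat.le_induction with
  | base => exact ⟨le_rfl, le_rfl⟩
  | succ t' _ ih =>
    rcases h : D.walk y t' with ⟨e, i, j⟩
    rw [h] at ih
    rcases D.walk_succ_cases y t' h with ⟨_, h0, h⟩ | ⟨_, h⟩ <;> rw [h] <;> simp only [] at ih ⊢ <;>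
      omega

theorem Visits.exists_walk {D : PipeDiagram n} {y : Fin n} {e : EntrySide} {i j : Fin n}
    (h : D.Visits y e i j) : ∃ t, D.walk y t = (e, i.val, j.val) := by
  induction h with
  | start i hi =>
    suffices ∀ t ≤ y.val, D.walk y t = (.south, n + y.val - t, y.val) by
      refine ⟨y.val + 1, ?_⟩
      have hy := this y.val le_rfl
      rcases D.walk_succ_cases y _ hy with ⟨_, _, h⟩ | ⟨h, _⟩
      · rw [h]; congr 2; omega
      · rw [D.extTile_below (by omega) y.is_lt] at h; simp [Tile.exit] at h
    intro t
    induction t with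
    | zero => intro _; rfl
    | succ t ih =>
      intro ht
      rcases D.walk_succ_cases y _ (ih (by omega)) with ⟨_, _, h⟩ | ⟨h, _⟩
      · rw [h]; congr 2
      · rw [D.extTile_below (by omega) y.is_lt] at h; simp [Tile.exit] at h
  | @up e i j i' _ ho hi ih =>
    obtain ⟨t, ht⟩ := ih
    refine ⟨t + 1, ?_⟩
    rcases D.walk_succ_cases y _ ht with ⟨_, _, h⟩ | ⟨h, _⟩
    · rw [h]; congr 2; omega
    · rw [extTile_val, ho] at h; simp at h
  | @right e i j j' _ ho hj ih =>
    obtain ⟨t, ht⟩ := ih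
    refine ⟨t + 1, ?_⟩
    rcases D.walk_succ_cases y _ ht with ⟨h, _, _⟩ | ⟨_, h⟩
    · rw [extTile_val, ho] at h; simp at h
    · rw [h, hj]

theorem Visits.walk_eq {D : PipeDiagram n} {y : Fin n} {e : EntrySide} {i j : Fin n}
    (h : D.Visits y e i j) : D.walk y (n + j.val - i.val) = (e, i.val, j.val) := by
  obtain ⟨t, ht⟩ := h.exists_walk
  have hd := D.walk_diagonal y t
  rw [ht] at hd
  simp only [] at hd
  rwa [show n + j.val - i.val = t by omega]

theorem visits_of_walk {D : PipeDiagram n} {y : Fin n} {t : ℕ} {e : EntrySide} {i j : Fin n}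
    (h : D.walk y t = (e, i.val, j.val)) : D.Visits y e i j := by
  have hp := D.onPipe_walk y t
  rw [h] at hp
  generalize hs : (e, i.val, j.val) = s at hp
  cases hp with
  | below i' hi => simp only [Prod.mk.injEq] at hs; omega
  | @inside _ i' j' hv =>
    simp only [Prod.mk.injEq] at hs
    obtain ⟨rfl, hi, hj⟩ := hs
    rwa [Fin.ext hi, Fin.ext hj]
  | beyond j' hj => simp only [Prod.mk.injEq] at hs; omega

theorem OnPipe.eq {D : PipeDiagram n} {y y' : Fin n} {s : EntrySide × ℕ × ℕ}
    (h : D.OnPipe y s) (h' : D.OnPipe y' s) : y = y' := by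
  generalize hs : s = s' at h'
  cases h with
  | below i hi =>
    cases h' with
    | below i' hi' => simp only [Prod.mk.injEq] at hs; exact Fin.ext hs.2.2
    | inside hv => simp only [Prod.mk.injEq] at hs; omega
    | beyond => simp at hs
  | inside hv =>
    cases h' with
    | below i' hi' => simp only [Prod.mk.injEq] at hs; omega
    | inside hv' =>
      simp only [Prod.mk.injEq] at hs
      obtain ⟨rfl, hi, hj⟩ := hs
      rw [Fin.ext hi, Fin.ext hj] at hv
      exact hv.eq hv'
    | beyond => simp only [Prod.mk.injEq] at hs; omega
  | beyond j hj hv =>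
    cases h' with
    | below i' hi' => simp at hs
    | inside hv => simp only [Prod.mk.injEq] at hs; omega
    | beyond j' hj' hv' =>
      simp only [Prod.mk.injEq] at hs
      rw [Fin.ext hs.2.1] at hv
      exact hv.eq hv'

theorem IsPipe.walk_eq {D : PipeDiagram n} {y x : Fin n} (h : D.IsPipe y x) :
    D.walk y (2 * n) = (.west, x.val, n + x.val) := by
  obtain ⟨e, j, hj, hv, ho⟩ := h
  have hw := hv.walk_eq
  suffices ∀ k, D.walk y (n + j.val - x.val + (k + 1)) = (.west, x.val, n + k) by
    have := this x.val
    rwa [show n + j.val - x.val + (x.val + 1) = 2 * n by omega] at this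
  intro k
  induction k with
  | zero =>
    rcases D.walk_succ_cases y _ hw with ⟨h, _⟩ | ⟨_, h⟩
    · rw [extTile_val, ho] at h; simp at h
    · rw [h, hj]; rfl
  | succ k ih =>
    rcases D.walk_succ_cases y _ ih with ⟨h, _⟩ | ⟨_, h⟩
    · rw [D.extTile_beyond (by omega)] at h; simp [Tile.exit] at h
    · exact h

theorem Visits.start_le {D : PipeDiagram n} {y : Fin n} {e : EntrySide} {i j : Fin n}
    (h : D.Visits y e i j) : y ≤ j := by
  have := (D.walk_mono y (Nat.zero_le (n + j.val - i.val))).2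
  rw [h.walk_eq] at this
  exact this

theorem Visits.exit_le {D : PipeDiagram n} {y x : Fin n} {e : EntrySide} {i j : Fin n}
    (h : D.Visits y e i j) (hx : D.IsPipe y x) : x ≤ i := by
  have := (D.walk_mono y (show n + j.val - i.val ≤ 2 * n by omega)).1
  rw [h.walk_eq, hx.walk_eq] at this
  exact this

theorem Visits.southwest_total {D : PipeDiagram n} {y : Fin n} {e e' : EntrySide}
    {i j i' j' : Fin n} (h : D.Visits y e i j) (h' : D.Visits y e' i' j') :
    (i' ≤ i ∧ j ≤ j') ∨ (i ≤ i' ∧ j' ≤ j) := by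
  rcases le_total (n + j.val - i.val) (n + j'.val - i'.val) with ht | ht
  · have := D.walk_mono y ht
    rw [h.walk_eq, h'.walk_eq] at this
    exact Or.inl this
  · have := D.walk_mono y ht
    rw [h.walk_eq, h'.walk_eq] at this
    exact Or.inr this

/-- The place, counted from northwest to southeast, of a position on its diagonal. -/
def key : EntrySide × ℕ × ℕ → ℕ
  | (.west, _, j) => 2 * j
  | (.south, _, j) => 2 * j + 1

/-- The two pipes come into the same cross after `t` steps. -/
def CrossTime (D : PipeDiagram n) (y y' : Fin n) (t : ℕ) : Prop :=
  (D.walk y t).2 = (D.walk y' t).2 ∧ D.extTile (D.walk y t).2.1 (D.walk y t).2.2 = .cross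

theorem key_walk_succ (D : PipeDiagram n) {y y' : Fin n} (hy : y ≠ y') (t : ℕ) :
    key (D.walk y (t + 1)) < key (D.walk y' (t + 1)) ↔
      Xor (key (D.walk y t) < key (D.walk y' t)) (D.CrossTime y y' t) := by
  have hne : D.walk y t ≠ D.walk y' t := fun h =>
    hy ((D.onPipe_walk y t).eq (h ▸ D.onPipe_walk y' t))
  have hd := D.walk_diagonal y t
  have hd' := D.walk_diagonal y' t
  unfold CrossTime
  rcases h : D.walk y t with ⟨e, i, j⟩
  rcases h' : D.walk y' t with ⟨e', i', j'⟩
  have hs := D.walk_succ_cases y t h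
  have hs' := D.walk_succ_cases y' t h'
  rw [h, h'] at hne
  rw [h] at hd
  rw [h'] at hd'
  simp only [] at hd hd'
  generalize D.walk y (t + 1) = u at *
  generalize D.walk y' (t + 1) = u' at *
  by_cases hj : j = j'
  · obtain rfl := hj
    obtain rfl : i = i' := by omega
    simp only [true_and]
    cases e <;> cases e' <;> cases ht : D.extTile i j <;>
      simp [ht, Tile.exit] at hs hs' hne ⊢ <;>
      simp [hs, hs', key, Xor] <;> omega
  · have hr : (i, j) ≠ (i', j') := fun h => hj (congrArg Prod.snd h)
    simp only [hr, false_and]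
    cases e <;> cases e' <;> rcases hs with ⟨_, _, rfl⟩ | ⟨_, rfl⟩ <;>
      rcases hs' with ⟨_, _, rfl⟩ | ⟨_, rfl⟩ <;>
      simp only [key, Xor, not_false_eq_true, and_true, false_and, or_false] <;> omega

open Classical in
theorem odd_card_crossTime (D : PipeDiagram n) {y y' : Fin n} (hy : y < y') (t : ℕ) :
    key (D.walk y t) < key (D.walk y' t) ↔
      ¬ Odd ((Finset.range t).filter (D.CrossTime y y')).card := by
  induction t with
  | zero => simp [walk_zero, key]; exact hy
  | succ t ih =>
    rw [D.key_walk_succ hy.ne, ih, Finset.range_add_one, Finset.filter_insert]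
    split_ifs with h
    · rw [Finset.card_insert_of_notMem (by simp), Nat.odd_add_one]
      simp [Xor, h]
    · simp [Xor, h]

open Classical in
theorem crossings_eq_card (D : PipeDiagram n) {y y' : Fin n} (hy : y ≠ y') :
    D.crossings y y' = ((Finset.range (2 * n)).filter (D.CrossTime y y')).card := by
  have hw : ∀ c, D.CrossAt y y' c →
      (D.walk y (n + c.2.val - c.1.val)).2 = (c.1.val, c.2.val) ∧
      (D.walk y' (n + c.2.val - c.1.val)).2 = (c.1.val, c.2.val) := by
    rintro c ⟨_, ⟨h, h'⟩ | ⟨h, h'⟩⟩ <;> rw [h.walk_eq, h'.walk_eq] <;> exact ⟨rfl, rfl⟩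
  rw [crossings, ← Set.ncard_coe_finset]
  refine Set.ncard_congr (fun c _ => n + c.2.val - c.1.val) ?_ ?_ ?_
  · intro c hc
    obtain ⟨h, h'⟩ := hw c hc
    simp only [Finset.coe_filter, Finset.mem_range, Set.mem_ofPred_eq, CrossTime, h, h', extTile_val]
    exact ⟨by omega, trivial, hc.1⟩
  · intro c c' hc hc' ht
    have h := (hw c hc).1
    rw [ht, (hw c' hc').1] at h
    simp only [Prod.mk.injEq] at h
    exact Prod.ext (Fin.ext h.1.symm) (Fin.ext h.2.symm)
  · intro t ht
    simp only [Finset.coe_filter, Finset.mem_range, Set.mem_ofPred_eq, CrossTime] at ht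
    obtain ⟨_, hs, hc⟩ := ht
    have hd := D.walk_diagonal y t
    have hne : D.walk y t ≠ D.walk y' t := fun h =>
      hy ((D.onPipe_walk y t).eq (h ▸ D.onPipe_walk y' t))
    rcases h : D.walk y t with ⟨e, i, j⟩
    rcases h' : D.walk y' t with ⟨e', i', j'⟩
    simp only [h, h', Prod.mk.injEq] at hs hc hd
    obtain ⟨rfl, rfl⟩ := hs
    have hij : i < n ∧ j < n := by
      by_contra hij
      rw [extTile, dif_neg hij] at hc
      split_ifs at hc
    refine ⟨(⟨i, hij.1⟩, ⟨j, hij.2⟩), ⟨?_, ?_⟩, by simp only []; omega⟩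
    · rw [← hc]; simp [extTile, hij]
    · have v : D.Visits y e ⟨i, hij.1⟩ ⟨j, hij.2⟩ := visits_of_walk h
      have v' : D.Visits y' e' ⟨i, hij.1⟩ ⟨j, hij.2⟩ := visits_of_walk h'
      rw [h, h'] at hne
      cases e <;> cases e' <;> simp at hne
      · exact Or.inr ⟨v, v'⟩
      · exact Or.inl ⟨v, v'⟩

/-- Two pipes cross an odd number of times if and only if they form an inversion. -/
theorem odd_crossings_iff (D : PipeDiagram n) {y y' x x' : Fin n} (hy : y < y')
    (h : D.IsPipe y x) (h' : D.IsPipe y' x') : Odd (D.crossings y y') ↔ x' < x := by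
  have hk := D.odd_card_crossTime hy (2 * n)
  rw [D.crossings_eq_card hy.ne]
  rw [h.walk_eq, h'.walk_eq] at hk
  have hx : x ≠ x' := by
    rintro rfl
    exact hy.ne (h.eq h')
  simp only [key] at hk
  rw [← not_iff_not, ← hk]
  have := Fin.val_ne_of_ne hx
  rw [not_lt, Fin.le_def]
  omega

theorem crossAt_comm {D : PipeDiagram n} {y y' : Fin n} {c : Fin n × Fin n} :
    D.CrossAt y y' c ↔ D.CrossAt y' y c := by
  unfold CrossAt; tauto

theorem crossings_comm (D : PipeDiagram n) (y y' : Fin n) :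
    D.crossings y y' = D.crossings y' y := by
  simp only [crossings, crossAt_comm (y := y)]

theorem exists_turn_of_walk {D : PipeDiagram n} {y : Fin n} {t t' i j : ℕ}
    (h : D.walk y t = (.west, i, j)) (ht : t ≤ t') (hi : (D.walk y t').2.1 < i) :
    ∃ j', j ≤ j' ∧ (D.extTile i j').exit .west = some .north := by
  suffices (∃ j', j ≤ j' ∧ D.walk y t' = (.west, i, j')) ∨
      ∃ j', j ≤ j' ∧ (D.extTile i j').exit .west = some .north by
    rcases this with ⟨j', _, h'⟩ | h'
    · rw [h'] at hi; exact absurd hi (lt_irrefl _)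
    · exact h'
  clear hi
  induction t', ht using Nat.le_induction with
  | base => exact Or.inl ⟨j, le_rfl, h⟩
  | succ t' _ ih =>
    rcases ih with ⟨j', hj, h'⟩ | h'
    · rcases D.walk_succ_cases y t' h' with ⟨ho, _⟩ | ⟨_, h'⟩
      · exact Or.inr ⟨j', hj, ho⟩
      · exact Or.inl ⟨j' + 1, by omega, h'⟩
    · exact Or.inr h'

/-- If two pipes meet again after a cross, then the one that leaves the cross to the east turns
north on its way. -/
theorem exists_turn {D : PipeDiagram n} {y y' : Fin n} {c c' : Fin n × Fin n} {e e' : EntrySide}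
    (h : D.CrossAt y y' c') (hv : D.Visits y e c.1 c.2) (hv' : D.Visits y' e' c.1 c.2)
    (hne : c' ≠ c) (hr : c.1 ≤ c'.1) (hc : c'.2 ≤ c.2) :
    ∃ i j : Fin n, (D.tile i j).exit .west = some .north ∧ c.1 < i ∧ c'.2 < j := by
  obtain ⟨ht, h⟩ := h
  wlog hw : D.Visits y .west c'.1 c'.2 ∧ D.Visits y' .south c'.1 c'.2 generalizing y y' e e'
  · exact this hv' hv (by tauto) (by tauto)
  obtain ⟨h, h'⟩ := hw
  have hlt : n + c'.2.val - c'.1.val < n + c.2.val - c.1.val := by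
    have : c'.1.val ≠ c.1.val ∨ c'.2.val ≠ c.2.val := by
      by_contra! hcon
      exact hne (Prod.ext (Fin.ext hcon.1) (Fin.ext hcon.2))
    rw [Fin.le_def] at hr hc
    omega
  have hi : c.1.val < c'.1.val := by
    have hm := (D.walk_mono y' (Nat.succ_le_of_lt hlt)).1
    rcases D.walk_succ_cases y' _ h'.walk_eq with ⟨_, h0, hs⟩ | ⟨hs, _⟩
    · rw [Nat.succ_eq_add_one, hs, hv'.walk_eq] at hm
      simp only [] at hm
      omega
    · rw [extTile_val, ht] at hs; simp [Tile.exit] at hs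
  rcases D.walk_succ_cases y _ h.walk_eq with ⟨hs, _⟩ | ⟨_, hs⟩
  · rw [extTile_val, ht] at hs; simp [Tile.exit] at hs
  · obtain ⟨j, hj, ho⟩ := exists_turn_of_walk hs (Nat.succ_le_of_lt hlt)
      (by rw [hv.walk_eq]; exact hi)
    have hjn : j < n := by
      by_contra hjn
      rw [D.extTile_beyond (by omega)] at ho
      simp [Tile.exit] at ho
    refine ⟨c'.1, ⟨j, hjn⟩, ?_, hi, Fin.lt_def.2 (by simp only []; omega)⟩
    rwa [← extTile_val]

/-- The pipes that meet at the cell `c` have crossed before. -/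
def CrossedBefore (D : PipeDiagram n) (c : Fin n × Fin n) : Prop :=
  ∃ y y' : Fin n, D.Visits y .west c.1 c.2 ∧ D.Visits y' .south c.1 c.2 ∧
    ∃ c' : Fin n × Fin n, c' ≠ c ∧ c.1 ≤ c'.1 ∧ c'.2 ≤ c.2 ∧ D.CrossAt y y' c'

theorem Visits.eq_column {D : PipeDiagram n} {y : Fin n} {i j : Fin n}
    (h : D.Visits y .south i j)
    (hno : ∀ i', i < i' → (D.tile i' j).exit .west ≠ some .north) : y = j := by
  generalize he : EntrySide.south = e at h
  induction h with
  | start => rfl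
  | @up e i j i' hv ho hi ih =>
    have hlt : i' < i := Fin.lt_def.2 (by omega)
    cases e with
    | west => exact absurd ho (hno i hlt)
    | south => exact ih (fun k hk => hno k (hlt.trans hk)) rfl
  | right => simp at he

theorem IsPipe.exists_turn_east {D : PipeDiagram n} {y i j : Fin n} (h : D.IsPipe y i)
    (hE : ¬ (D.tile i j).East) :
    ∃ j', j < j' ∧ D.Visits y .south i j' := by
  obtain ⟨e, k, hk, hv, ho⟩ := h
  have hjk : j < k := by
    rcases lt_or_eq_of_le (show j ≤ k from Fin.le_def.2 (by omega)) with h | rfl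
    · exact h
    · exact absurd ⟨e, ho⟩ hE
  clear hk ho
  induction hv with
  | start i hi => exact ⟨_, hjk, .start i hi⟩
  | up i' hv ho hi => exact ⟨_, hjk, .up i' hv ho hi⟩
  | @right e i k k' hv ho hk ih =>
    refine ih hE ?_
    rcases lt_or_eq_of_le (show j ≤ k from Fin.le_def.2 (by rw [Fin.lt_def] at hjk; omega))
      with h | rfl
    · exact h
    · exact absurd ⟨e, ho⟩ hE

theorem exists_turn_south {D : PipeDiagram n} {i j : Fin n} (hS : ¬ (D.tile i j).South) :
    ∃ i', i < i' ∧ D.Visits j .south i' j ∧ (D.tile i' j).exit .south = some .east := by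
  suffices ∀ (m : ℕ) (k : Fin n), k.val = m → i ≤ k → D.Visits j .south k j →
      ∃ i', i < i' ∧ D.Visits j .south i' j ∧ (D.tile i' j).exit .south = some .east by
    have hi := i.is_lt
    exact this _ ⟨n - 1, by omega⟩ rfl (Fin.le_def.2 (by simp only []; omega))
      (.start _ (by simp only []; omega))
  intro m
  induction m with
  | zero =>
    intro k hk hik hv
    obtain rfl : i = k := Fin.ext (by rw [Fin.le_def] at hik; omega)
    exact absurd hv.exit_ne_none hS
  | succ m ih =>
    intro k hk hik hv
    have hlt : i < k := by
      rcases lt_or_eq_of_le hik with h | rfl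
      · exact h
      · exact absurd hv.exit_ne_none hS
    rw [Fin.lt_def] at hlt
    cases ho : (D.tile k j).exit .south with
    | none => exact absurd ho hv.exit_ne_none
    | some o =>
      cases o with
      | east => exact ⟨k, hlt, hv, ho⟩
      | north =>
        exact ih ⟨m, by omega⟩ rfl (Fin.le_def.2 (by simp only []; omega)) (.up _ hv ho hk.symm)

theorem Visits.isPipe_of_no_turn {D : PipeDiagram n} {y : Fin n} {e : EntrySide} {i j : Fin n}
    (h : D.Visits y e i j) (ho : (D.tile i j).exit e = some .east)
    (hno : ∀ j', j < j' → (D.tile i j').exit .west ≠ some .north) : D.IsPipe y i := by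
  by_cases hj : j.val + 1 = n
  · exact ⟨e, j, hj, h, ho⟩
  · have hlt : j.val + 1 < n := by omega
    have hj' : j < ⟨j.val + 1, hlt⟩ := Fin.lt_def.2 (by simp)
    have hv := h.right ⟨j.val + 1, hlt⟩ ho rfl
    refine hv.isPipe_of_no_turn ?_ fun k hk => hno k (hj'.trans hk)
    cases ho' : (D.tile i ⟨j.val + 1, hlt⟩).exit .west with
    | none => exact absurd ho' hv.exit_ne_none
    | some o =>
      cases o with
      | east => rfl
      | north => exact absurd ho' (hno _ hj')
termination_by n - j.val

/-- If the pipes of every bump have crossed before, then there is an inversion weakly to the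
southeast of every cell in which a pipe turns north. -/
theorem exists_inversion_of_turn {D : PipeDiagram n}
    (hD : ∀ c, D.tile c.1 c.2 = .bump → D.CrossedBefore c) {i j : Fin n}
    (h : (D.tile i j).exit .west = some .north) :
    ∃ a b, i ≤ a ∧ a < b ∧ j ≤ D.perm b ∧ D.perm b < D.perm a := by
  by_cases hex : ∃ i' j', i ≤ i' ∧ j ≤ j' ∧ (i ≠ i' ∨ j ≠ j') ∧
      (D.tile i' j').exit .west = some .north
  · obtain ⟨i', j', hi, hj, hne, h'⟩ := hex
    have : (n - i'.val) + (n - j'.val) < (n - i.val) + (n - j.val) := by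
      rw [Fin.le_def] at hi hj
      simp only [ne_eq, Fin.ext_iff] at hne
      omega
    obtain ⟨a, b, ha, hab, hb, hp⟩ := exists_inversion_of_turn hD h'
    exact ⟨a, b, hi.trans ha, hab, hj.trans hb, hp⟩
  · push Not at hex
    cases ht : D.tile i j with
    | bump =>
      exfalso
      obtain ⟨y, y', hv, hv', c, hne, hr, hc, hx⟩ := hD (i, j) ht
      simp only [] at hv hv' hr hc
      obtain rfl := hv'.eq_column fun i' hi => hex i' j hi.le le_rfl (Or.inl hi.ne)
      have hyc : y' = c.2 := by
        refine le_antisymm ?_ hc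
        rcases hx.2 with h | h
        · exact h.2.start_le
        · exact h.2.start_le
      have hic : i.val < c.1.val := by
        refine lt_of_le_of_ne hr fun hcon => hne (Prod.ext (Fin.ext hcon.symm) hyc.symm)
      rcases hx.2 with h | h
      · rcases D.walk_succ_cases y _ h.1.walk_eq with ⟨hs, _⟩ | ⟨_, hs⟩
        · rw [extTile_val, hx.1] at hs; simp [Tile.exit] at hs
        · have hm := (D.walk_mono y
            (show n + c.2.val - c.1.val + 1 ≤ n + y'.val - i.val by
              rw [Fin.le_def] at hr; rw [hyc]; omega)).2
          rw [hs, hv.walk_eq, ← hyc] at hm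
          simp only [] at hm
          omega
      · cases h.2 with
        | right _ h _ hj =>
          have := Fin.le_def.1 h.start_le
          omega
    | jelbow =>
      obtain ⟨k, hk, hv⟩ := (D.isPipe_perm i).exists_turn_east (j := j)
        (by rw [ht]; rintro ⟨e, he⟩; cases e <;> simp [Tile.exit] at he)
      have hpi := hv.eq_column fun i' hi => hex i' k hi.le hk.le (Or.inl hi.ne)
      obtain ⟨l, hl, hv', ho⟩ := D.exists_turn_south (i := i) (j := j)
        (by simp [ht, Tile.South, Tile.exit])
      have hp := hv'.isPipe_of_no_turn ho
        fun j' hj => hex l j' hl.le hj.le (Or.inl hl.ne)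
      rw [← perm_eq_iff] at hp
      exact ⟨i, l, le_rfl, hl, hp.ge, by rwa [hp, hpi]⟩
    | _ => simp [ht, Tile.exit] at h
termination_by (n - i.val) + (n - j.val)

end PipeDiagram

namespace PipeDiagram

variable {n : ℕ}

theorem Visits.of_agree {D D' : PipeDiagram n} {y : Fin n} {e : EntrySide} {i j : Fin n}
    (h : D.Visits y e i j)
    (hD : ∀ a b, i ≤ a → b ≤ j → (a, b) ≠ (i, j) → D.tile a b = D'.tile a b) :
    D'.Visits y e i j := by
  induction h with
  | start i hi => exact .start i hi
  | @up e i j i' hv ho hi ih =>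
    have hlt : i' < i := Fin.lt_def.2 (by omega)
    refine (ih fun a b ha hb _ => hD a b (hlt.le.trans ha) hb ?_).up i' ?_ hi
    · exact fun h => (hlt.trans_le ha).ne' (congrArg Prod.fst h)
    · rwa [← hD i j hlt.le le_rfl fun h => hlt.ne' (congrArg Prod.fst h)]
  | @right e i j j' hv ho hj ih =>
    have hlt : j < j' := Fin.lt_def.2 (by omega)
    refine (ih fun a b ha hb _ => hD a b ha (hb.trans hlt.le) ?_).right j' ?_ hj
    · exact fun h => (hb.trans_lt hlt).ne (congrArg Prod.snd h)
    · rwa [← hD i j le_rfl hlt.le fun h => hlt.ne (congrArg Prod.snd h)]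

theorem CrossAt.of_agree {D D' : PipeDiagram n} {y y' : Fin n} {c : Fin n × Fin n}
    (h : D.CrossAt y y' c)
    (hD : ∀ a b, c.1 ≤ a → b ≤ c.2 → D.tile a b = D'.tile a b) : D'.CrossAt y y' c := by
  have hv : ∀ y e, D.Visits y e c.1 c.2 → D'.Visits y e c.1 c.2 :=
    fun y e h => h.of_agree fun a b ha hb _ => hD a b ha hb
  refine ⟨hD c.1 c.2 le_rfl le_rfl ▸ h.1, ?_⟩
  exact h.2.imp (fun h => ⟨hv _ _ h.1, hv _ _ h.2⟩) fun h => ⟨hv _ _ h.1, hv _ _ h.2⟩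

theorem IsRedundant.of_agree {D D' : PipeDiagram n} {c : Fin n × Fin n} (h : D.IsRedundant c)
    (hD : ∀ a b, c.1 ≤ a → b ≤ c.2 → D.tile a b = D'.tile a b) : D'.IsRedundant c := by
  obtain ⟨y, y', hc, c', hne, h1, h2, hc'⟩ := h
  exact ⟨y, y', hc.of_agree hD, c', hne, h1, h2,
    hc'.of_agree fun a b ha hb => hD a b (h1.trans ha) (hb.trans h2)⟩

theorem CrossedBefore.of_agree {D D' : PipeDiagram n} {c : Fin n × Fin n} (h : D.CrossedBefore c)
    (hD : ∀ a b, c.1 ≤ a → b ≤ c.2 → (a, b) ≠ c → D.tile a b = D'.tile a b) :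
    D'.CrossedBefore c := by
  obtain ⟨y, y', hv, hv', c', hne, h1, h2, hc'⟩ := h
  refine ⟨y, y', hv.of_agree hD, hv'.of_agree hD, c', hne, h1, h2,
    hc'.of_agree fun a b ha hb => hD a b (h1.trans ha) (hb.trans h2) ?_⟩
  rintro rfl
  exact hne (Prod.ext (le_antisymm ha h1) (le_antisymm h2 hb))

theorem replaceCross_tile_of_ne (D : PipeDiagram n) {c : Fin n × Fin n} {a b : Fin n}
    (h : (a, b) ≠ c) : (D.replaceCross c).tile a b = D.tile a b :=
  if_neg fun h' => h h'.1

theorem IsRedundant.crossedBefore {D : PipeDiagram n} {c : Fin n × Fin n}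
    (h : D.IsRedundant c) : D.CrossedBefore c := by
  obtain ⟨y, y', ⟨_, h | h⟩, c', hne, h1, h2, hc'⟩ := h
  · exact ⟨y, y', h.1, h.2, c', hne, h1, h2, hc'⟩
  · exact ⟨y', y, h.2, h.1, c', hne, h1, h2, crossAt_comm.1 hc'⟩

/-- The cells in `l` are resolved: none of them is a redundant cross, and every bump is among
them and joins two pipes that have crossed before. -/
structure Resolved (D : PipeDiagram n) (l : List (Fin n × Fin n)) : Prop where
  not_isRedundant : ∀ c ∈ l, ¬ D.IsRedundant c
  mem_of_bump : ∀ c : Fin n × Fin n, D.tile c.1 c.2 = .bump → c ∈ l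
  crossedBefore : ∀ c : Fin n × Fin n, D.tile c.1 c.2 = .bump → D.CrossedBefore c

theorem Resolved.resolveAt {D : PipeDiagram n} {l : List (Fin n × Fin n)} (h : D.Resolved l)
    {c : Fin n × Fin n} (hc : ∀ a ∈ l, ¬ (a.1 ≤ c.1 ∧ c.2 ≤ a.2)) :
    (D.resolveAt c).Resolved (l ++ [c]) := by
  unfold PipeDiagram.resolveAt
  split_ifs with hr
  · have hne : ∀ a ∈ l, ∀ i j, a.1 ≤ i → j ≤ a.2 → D.tile i j = (D.replaceCross c).tile i j := by
      intro a ha i j hi hj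
      refine (D.replaceCross_tile_of_ne ?_).symm
      rintro rfl
      exact hc a ha ⟨hi, hj⟩
    have hb : (D.replaceCross c).tile c.1 c.2 = .bump := by
      obtain ⟨_, _, hx, _⟩ := hr
      exact if_pos ⟨rfl, hx.1⟩
    have hd : ∀ a : Fin n × Fin n, (D.replaceCross c).tile a.1 a.2 = .bump →
        a = c ∨ D.tile a.1 a.2 = .bump := by
      intro a ha
      by_cases hac : a = c
      · exact Or.inl hac
      · exact Or.inr (by rwa [D.replaceCross_tile_of_ne hac] at ha)
    refine ⟨fun a ha hra => ?_, fun a ha => ?_, fun a ha => ?_⟩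
    · rcases List.mem_append.1 ha with ha | ha
      · exact h.not_isRedundant a ha (hra.of_agree fun i j hi hj => (hne a ha i j hi hj).symm)
      · obtain rfl := List.mem_singleton.1 ha
        obtain ⟨_, _, hx, _⟩ := hra
        rw [hx.1] at hb
        cases hb
    · rcases hd a ha with rfl | ha
      · simp
      · exact List.mem_append_left _ (h.mem_of_bump a ha)
    · rcases hd a ha with rfl | ha
      · exact hr.crossedBefore.of_agree fun i j _ _ hij => (D.replaceCross_tile_of_ne hij).symm
      · exact (h.crossedBefore a ha).of_agree
          fun i j hi hj _ => hne a (h.mem_of_bump a ha) i j hi hj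
  · refine ⟨fun a ha => ?_, fun a ha => List.mem_append_left _ (h.mem_of_bump a ha),
      h.crossedBefore⟩
    rcases List.mem_append.1 ha with ha | ha
    · exact h.not_isRedundant a ha
    · rwa [List.mem_singleton.1 ha]

theorem Resolved.foldl {l : List (Fin n × Fin n)} :
    ∀ {D : PipeDiagram n} {l' : List (Fin n × Fin n)}, D.Resolved l' →
      (l' ++ l).Pairwise (fun a c => ¬ (a.1 ≤ c.1 ∧ c.2 ≤ a.2)) →
      (l.foldl PipeDiagram.resolveAt D).Resolved (l' ++ l) := by
  induction l with
  | nil => intro D l' h _; simpa using h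
  | cons c l ih =>
    intro D l' h hl
    have := ih (h.resolveAt fun a ha => (List.pairwise_append.1 hl).2.2 a ha c (by simp))
      (by simpa using hl)
    simpa using this

theorem foldl_resolveAt_tile (l : List (Fin n × Fin n)) :
    ∀ (D : PipeDiagram n) (i j : Fin n), (l.foldl PipeDiagram.resolveAt D).tile i j = .bump ∨
      (l.foldl PipeDiagram.resolveAt D).tile i j = D.tile i j := by
  induction l with
  | nil => intro D i j; exact Or.inr rfl
  | cons c l ih =>
    intro D i j
    rcases ih (D.resolveAt c) i j with h | h
    · exact Or.inl h
    · rw [List.foldl_cons, h]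
      unfold PipeDiagram.resolveAt
      split_ifs
      · change D.bumpTile c i j = _ ∨ D.bumpTile c i j = _
        unfold bumpTile
        split_ifs
        · exact Or.inl rfl
        · exact Or.inr rfl
      · exact Or.inr rfl

end PipeDiagram

theorem pairwise_cellOrder (n : ℕ) :
    (cellOrder n).Pairwise (fun a c => ¬ (a.1 ≤ c.1 ∧ c.2 ≤ a.2)) := by
  have hlt : (List.finRange n).Pairwise (· < ·) := List.pairwise_lt_finRange n
  refine List.pairwise_flatMap.2 ⟨fun j _ => ?_, hlt.imp fun hj => ?_⟩
  · rw [List.pairwise_map, List.pairwise_reverse]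
    exact hlt.imp fun hi h => absurd h.1 (not_le.2 hi)
  · simp only [List.mem_map, List.mem_reverse]
    rintro _ ⟨i, _, rfl⟩ _ ⟨i', _, rfl⟩ h
    exact absurd h.2 (not_le.2 hj)

theorem mem_cellOrder {n : ℕ} (c : Fin n × Fin n) : c ∈ cellOrder n :=
  List.mem_flatMap.2 ⟨c.2, List.mem_finRange _, List.mem_map.2 ⟨c.1, by simp, rfl⟩⟩

namespace PipeDiagram

variable {n : ℕ}

theorem exists_ordered_crosses {D : PipeDiagram n} {y y' : Fin n} (h : 2 ≤ D.crossings y y') :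
    ∃ c c' : Fin n × Fin n, D.CrossAt y y' c ∧ D.CrossAt y y' c' ∧ c' ≠ c ∧ c.1 ≤ c'.1 ∧
      c'.2 ≤ c.2 := by
  obtain ⟨c, hc, c', hc', hne⟩ := (Set.one_lt_ncard (Set.toFinite _)).1 h
  have hv : ∀ {c}, D.CrossAt y y' c → ∃ e, D.Visits y e c.1 c.2 := by
    rintro c ⟨_, h | h⟩ <;> exact ⟨_, h.1⟩
  obtain ⟨_, h1⟩ := hv hc
  obtain ⟨_, h2⟩ := hv hc'
  rcases h1.southwest_total h2 with h | h
  · exact ⟨c', c, hc', hc, hne, h.1, h.2⟩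
  · exact ⟨c, c', hc, hc', hne.symm, h.1, h.2⟩

theorem isReduced_of_not_isRedundant {D : PipeDiagram n} (h : ∀ c, ¬ D.IsRedundant c) :
    D.IsReduced := by
  intro y y' _
  by_contra! h2
  obtain ⟨c, c', hc, hc', hne, hr, hl⟩ := exists_ordered_crosses h2
  exact h c ⟨y, y', hc, c', hne, hr, hl, hc'⟩

/-- If two pipes meet again after a cross, then there is an inversion strictly to the southeast
of both of them. -/
theorem exists_inversion_of_meet {D : PipeDiagram n}
    (hD : ∀ c, D.tile c.1 c.2 = .bump → D.CrossedBefore c)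
    {y y' x x' : Fin n} (hx : D.IsPipe y x) (hx' : D.IsPipe y' x')
    {c c' : Fin n × Fin n} {e e' : EntrySide}
    (h : D.CrossAt y y' c') (hv : D.Visits y e c.1 c.2) (hv' : D.Visits y' e' c.1 c.2)
    (hne : c' ≠ c) (hr : c.1 ≤ c'.1) (hc : c'.2 ≤ c.2) :
    ∃ a b, x < a ∧ x' < a ∧ a < b ∧ y < D.perm b ∧ y' < D.perm b ∧ D.perm b < D.perm a := by
  obtain ⟨i, j, ht, hi, hj⟩ := exists_turn h hv hv' hne hr hc
  obtain ⟨a, b, ha, hab, hb, hp⟩ := exists_inversion_of_turn hD ht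
  have hs : y ≤ c'.2 ∧ y' ≤ c'.2 := by
    rcases h.2 with h | h <;> exact ⟨h.1.start_le, h.2.start_le⟩
  exact ⟨a, b, ((hv.exit_le hx).trans_lt hi).trans_le ha, 
    ((hv'.exit_le hx').trans_lt hi).trans_le ha,
    hab, (hs.1.trans_lt hj).trans_le hb, (hs.2.trans_lt hj).trans_le hb, hp⟩

end PipeDiagram

theorem containsPattern_1243 {n : ℕ} {w : Equiv.Perm (Fin n)} {a b c d : Fin n} (hab : a < b)
    (hbc : b < c) (hcd : c < d) (h₁ : w a < w b) (h₂ : w b < w d) (h₃ : w d < w c) :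
    ContainsPattern w pattern1243 := by
  refine ⟨![a, b, c, d], ?_, ?_⟩
  · rw [Fin.strictMono_iff_lt_succ]
    intro i
    fin_cases i
    exacts [hab, hbc, hcd]
  · have p0 : pattern1243 0 = 0 := by decide
    have p1 : pattern1243 1 = 1 := by decide
    have p2 : pattern1243 2 = 3 := by decide
    have p3 : pattern1243 3 = 2 := by decide
    intro s t
    fin_cases s <;> fin_cases t <;> simp [p0, p1, p2, p3] <;> omega

theorem containsPattern_2143 {n : ℕ} {w : Equiv.Perm (Fin n)} {a b c d : Fin n} (hab : a < b)
    (hbc : b < c) (hcd : c < d) (h₁ : w b < w a) (h₂ : w a < w d) (h₃ : w d < w c) :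
    ContainsPattern w pattern2143 := by
  refine ⟨![a, b, c, d], ?_, ?_⟩
  · rw [Fin.strictMono_iff_lt_succ]
    intro i
    fin_cases i
    exacts [hab, hbc, hcd]
  · have p0 : pattern2143 0 = 1 := by decide
    have p1 : pattern2143 1 = 0 := by decide
    have p2 : pattern2143 2 = 3 := by decide
    have p3 : pattern2143 3 = 2 := by decide
    intro s t
    fin_cases s <;> fin_cases t <;> simp [p0, p1, p2, p3] <;> omega

namespace PipeDiagram

variable {n : ℕ}

theorem containsPattern_of_meet {D : PipeDiagram n}
    (hD : ∀ c, D.tile c.1 c.2 = .bump → D.CrossedBefore c) {y y' : Fin n} (hy : y ≠ y')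
    {c c' : Fin n × Fin n} {e e' : EntrySide}
    (h : D.CrossAt y y' c') (hv : D.Visits y e c.1 c.2) (hv' : D.Visits y' e' c.1 c.2)
    (hne : c' ≠ c) (hr : c.1 ≤ c'.1) (hc : c'.2 ≤ c.2) :
    (Even (D.crossings y y') → ContainsPattern D.perm pattern1243) ∧
      (Odd (D.crossings y y') → ContainsPattern D.perm pattern2143) := by
  wlog hlt : y < y' generalizing y y' e e'
  · rw [crossings_comm]
    exact this hy.symm (crossAt_comm.1 h) hv' hv (lt_of_le_of_ne (not_lt.1 hlt) hy.symm)
  obtain ⟨x, hx⟩ := D.exists_isPipe y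
  obtain ⟨x', hx'⟩ := D.exists_isPipe y'
  obtain ⟨a, b, hxa, hxa', hab, hyb, hyb', hba⟩ :=
    exists_inversion_of_meet hD hx hx' h hv hv' hne hr hc
  have hodd := D.odd_crossings_iff hlt hx hx'
  have hxx : x ≠ x' := by
    rintro rfl
    exact hy (hx.eq hx')
  have hp := (D.perm_eq_iff x y).2 hx
  have hp' := (D.perm_eq_iff x' y').2 hx'
  refine ⟨fun he => ?_, fun ho => ?_⟩
  · rw [← Nat.not_odd_iff_even, hodd, not_lt] at he
    exact containsPattern_1243 (lt_of_le_of_ne he hxx) hxa' hab (by rwa [hp, hp'])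
      (by rwa [hp']) hba
  · exact containsPattern_2143 (hodd.1 ho) hxa hab (by rwa [hp, hp']) (by rwa [hp']) hba

end PipeDiagram

namespace BPD

variable {n : ℕ}

theorem containsPattern_of_two_le (B : BPD n) {y y' : Fin n} (hy : y ≠ y')
    (h : 2 ≤ B.crossings y y') :
    (Even (B.crossings y y') → ContainsPattern B.perm pattern1243) ∧
      (Odd (B.crossings y y') → ContainsPattern B.perm pattern2143) := by
  obtain ⟨c, c', hc, hc', hne, hr, hl⟩ := PipeDiagram.exists_ordered_crosses h
  have hD : ∀ c, B.tile c.1 c.2 = .bump → B.CrossedBefore c :=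
    fun c h => absurd h (B.bumpless c.1 c.2)
  rcases hc.2 with h | h <;>
    exact PipeDiagram.containsPattern_of_meet hD hy hc' h.1 h.2 hne hr hl

theorem resolved_kDiagram (B : BPD n) : B.kDiagram.Resolved (cellOrder n) := by
  have h : B.toPipeDiagram.Resolved [] :=
    ⟨by simp, fun c h => absurd h (B.bumpless c.1 c.2),
      fun c h => absurd h (B.bumpless c.1 c.2)⟩
  exact h.foldl (by simpa using pairwise_cellOrder n)

theorem isReduced_kDiagram (B : BPD n) : B.kDiagram.IsReduced :=
  PipeDiagram.isReduced_of_not_isRedundant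
    fun c => B.resolved_kDiagram.not_isRedundant c (mem_cellOrder c)

theorem exists_bump_kDiagram (B : BPD n) (hB : ¬ B.IsReduced) :
    ∃ c : Fin n × Fin n, B.kDiagram.tile c.1 c.2 = .bump := by
  by_contra! hcon
  have htile : B.kDiagram.tile = B.tile := by
    funext i j
    exact (PipeDiagram.foldl_resolveAt_tile (cellOrder n) B.toPipeDiagram i j).resolve_left
      (hcon (i, j))
  have heq : B.kDiagram = B.toPipeDiagram := by
    rcases hK : B.kDiagram with ⟨t⟩
    rcases hB : B.toPipeDiagram with ⟨t'⟩
    rw [hK, hB] at htile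
    simp only [] at htile
    simp only [htile]
  exact hB (heq ▸ B.isReduced_kDiagram)

theorem type_containsPattern (B : BPD n) (hB : ¬ B.IsReduced) :
    ContainsPattern B.type pattern2143 := by
  obtain ⟨c, hc⟩ := B.exists_bump_kDiagram hB
  have hD := B.resolved_kDiagram.crossedBefore
  obtain ⟨y, y', hv, hv', c', hne, hr, hl, hx⟩ := hD c hc
  have hy : y ≠ y' := by
    rintro rfl
    have := hv.walk_eq.symm.trans hv'.walk_eq
    simp at this
  refine (PipeDiagram.containsPattern_of_meet hD hy hx hv hv' hne hr hl).2 ?_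
  have h1 := B.isReduced_kDiagram y y' hy
  have h0 : 0 < B.kDiagram.crossings y y' := (Set.ncard_pos (Set.toFinite _)).2 ⟨c', hx⟩
  rw [show B.kDiagram.crossings y y' = 1 by omega]
  exact odd_one

end BPD

theorem mainTheorem3 (n : ℕ) (B : BPD n) (hB : ¬ B.IsReduced) :
    ((ContainsPattern B.perm pattern1243 ∨ ContainsPattern B.perm pattern2143) ∧
      (∀ y y' : Fin n, y ≠ y' → B.crossings y y' ≠ 0 → Even (B.crossings y y') →
        ContainsPattern B.perm pattern1243) ∧
      (∀ y y' : Fin n, y ≠ y' → 2 ≤ B.crossings y y' → Odd (B.crossings y y') →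
        ContainsPattern B.perm pattern2143)) ∧
    ContainsPattern B.type pattern2143 := by
  refine ⟨⟨?_, fun y y' hy h0 he => ?_, fun y y' hy h2 => ?_⟩, B.type_containsPattern hB⟩
  · unfold PipeDiagram.IsReduced at hB
    push Not at hB
    obtain ⟨y, y', hy, h2⟩ := hB
    obtain ⟨he, ho⟩ := B.containsPattern_of_two_le hy h2
    exact (Nat.even_or_odd _).imp he ho
  · refine (B.containsPattern_of_two_le hy ?_).1 he
    obtain ⟨k, hk⟩ := he
    omega
  · exact (B.containsPattern_of_two_le hy h2).2
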